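/- Let $A$ be a commutative (associative) unital real algebra of dimension $n=p+1$ with basis $e_0,\dots,e_p$, where $e_0$ is the unit. Identify $\mathbb R^{n}$ with $A$ by $(x_0,\dots,x_p)\mapsto\sum_j x_je_j$, and let $\|\cdot\|$ be the Euclidean norm of $\mathbb R^n$, $dV=dy_0\wedge\dots\wedge dy_p$, and $\mathrm{Vol}$ the volume of the Euclidean unit ball of $\mathbb R^n$. A function $f:D\to A$ on an open set $D$ is called $A$-differentiable if it is differentiable at each point of $D$ and $$\frac{\partial f}{\partial x_m}=e_m\frac{\partial f}{\partial x_0}\qquad(m=1,\dots,p).$$ Write these equations as $\sum_{j=0}^p \frac{\partial f}{\partial x_j}a_m^j=0$, where $a_m^0=-e_m$, $a_m^m=e_0$ and $a_m^j=0$ otherwise $(m=1,\dots,p)$. If $$\sum_{m=0}^p e_m^2=0,$$ then the $A$-differentiable functions satisfy a Cauchy formula: there are elements $b_m^i\in A$ $(1\le m\le p,\ 0\le i\le p)$ with $$\sum_{m=1}^p a_m^jb_m^j=\frac{e_0}{n\,\mathrm{Vol}}\quad(0\le j\le p),\qquad \sum_{m=1}^p\left(a_m^jb_m^i+a_m^ib_m^j\right)=0\quad(i\ne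 j),$$ such that, with $\varphi_m(x,y)=\sum_{i=0}^p b_m^i(y_i-x_i)$, for every bounded open set $D\subset\mathbb R^n$ with smooth boundary, every $f:\overline D\to A$ that is continuous on $\overline D$ and $A$-differentiable in $D$, and every $x\in D$, $$f(x)=\int_{\partial D} f(y)\sum_{m=1}^p\Big(\sum_{j=0}^p a_m^j\frac{\partial}{\partial y_j}\Big)\lrcorner\Big(\frac{\varphi_m(x,y)}{\|y-x\|^{n}}\,dV\Big),$$ where $\partial D$ is oriented as the boundary of $D$. For $A=\mathbb C$ with the basis $(1,i)$ the condition is $1+i^2=0$, which holds. -/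

import Mathlib

open scoped ContDiff

namespace AlgebraCauchy

/-- Euclidean space `ℝ^(p+1)`, with coordinates `x_0, …, x_p`.  When a basis `e_0, …, e_p` of `A`
is given, its point `x` stands for the element `∑ x_j e_j` of `A`. -/
abbrev E (p : ℕ) : Type := EuclideanSpace ℝ (Fin (p + 1))

/-! ### Functions with values in a finite-dimensional algebra

The algebra carries no norm: continuity, derivatives and integrals of `A`-valued functions are
taken on their components in the basis `e` (none of them depends on the choice of the basis). -/

section Algebra

variable {p : ℕ} {A : Type*} [CommRing A] [Algebra ℝ A] (e : Module.Basis (Fin (p + 1)) ℝ A)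

/-- The components `(f^0, …, f^p)` of `f = ∑ f^k e_k`. -/
noncomputable def components {X : Type*} (f : X → A) : X → (Fin (p + 1) → ℝ) :=
  fun y => e.equivFun (f y)

/-- The partial derivative `∂f/∂x_j` at `x`. -/
noncomputable def partialDeriv (f : E p → A) (j : Fin (p + 1)) (x : E p) : A :=
  e.equivFun.symm (fderiv ℝ (components e f) x (EuclideanSpace.single j 1))

/-- `f` is `A`-differentiable on `D`: it is differentiable at each point of `D`, and
`∂f/∂x_m = e_m ∂f/∂x_0` there for each `m`. -/
def IsADifferentiableOn (f : E p → A) (D : Set (E p)) : Prop :=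
  ∀ x ∈ D, DifferentiableAt ℝ (components e f) x ∧
    ∀ m : Fin (p + 1), partialDeriv e f m x = e m * partialDeriv e f 0 x

end Algebra

/-! ### Domains with smooth boundary and integration over the boundary -/

/-- A chart of the boundary of `D`: an open set `U` in which, for some coordinate `x_j`, some sign
`s = ±1` and some smooth function `γ` of the other coordinates, `D` is given by `x_j > γ`
(if `s = 1`), respectively by `x_j < γ` (if `s = -1`). -/
structure GraphChart {p : ℕ} (D : Set (E p)) where
  U : Set (E p)
  isOpen_U : IsOpen U
  j : Fin (p + 1)
  s : ℝ
  sign_s : s = 1 ∨ s = -1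
  γ : EuclideanSpace ℝ (Fin p) → ℝ
  smooth_γ : ContDiff ℝ ∞ γ
  mem_iff : ∀ y ∈ U, y ∈ D ↔ 0 < s * (y j - γ (WithLp.toLp 2 fun i => y (j.succAbove i)))

/-- The boundary of `D` is smooth: near each of its points it is the graph of a smooth function of
all but one of the coordinates, with `D` on exactly one side. -/
def HasSmoothBoundary {p : ℕ} (D : Set (E p)) : Prop :=
  ∀ a ∈ frontier D, ∃ c : GraphChart D, a ∈ c.U

namespace GraphChart

variable {p : ℕ} {D : Set (E p)} (c : GraphChart D)

/-- The parametrization `t ↦ (t, γ(t))` of the graph, with `γ(t)` as the coordinate number `j`. -/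
noncomputable def param (t : EuclideanSpace ℝ (Fin p)) : E p :=
  WithLp.toLp 2 (c.j.insertNth (α := fun _ => ℝ) (c.γ t) fun i => t i)

/-- The outward normal vector `ν √(1 + |∇γ|²)` to `D` at `param t`; so `ν dS` is
`outwardNormal t dt` in this parametrization. -/
noncomputable def outwardNormal (t : EuclideanSpace ℝ (Fin p)) : Fin (p + 1) → ℝ :=
  c.j.insertNth (α := fun _ => ℝ) (-c.s)
    fun i => c.s * fderiv ℝ c.γ t (EuclideanSpace.single i 1)

/-- The pullback under `param`, for the boundary orientation, of the `A`-valued form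
`(∑ V_k ∂/∂y_k) ⌟ dV`, that is, of `⟨V, ν⟩ dS`. -/
noncomputable def pullback {A : Type*} [CommRing A] [Algebra ℝ A]
    (V : Fin (p + 1) → E p → A) (t : EuclideanSpace ℝ (Fin p)) : A :=
  ∑ k, c.outwardNormal t k • V k (c.param t)

end GraphChart

/-- Finitely many charts of the boundary of `D` and a smooth partition of unity on the boundary
that is subordinate to them. -/
structure BoundaryAtlas {p : ℕ} (D : Set (E p)) where
  N : ℕ
  chart : Fin N → GraphChart D
  χ : Fin N → E p → ℝ
  smooth_χ : ∀ i, ContDiff ℝ ∞ (χ i)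
  nonneg_χ : ∀ i y, 0 ≤ χ i y
  support_χ : ∀ i, tsupport (χ i) ⊆ (chart i).U
  sum_χ : ∀ y ∈ frontier D, ∑ i, χ i y = 1

/-- The summand of the integral over the boundary that comes from the chart number `i`. -/
noncomputable def BoundaryAtlas.integrand {p : ℕ} {D : Set (E p)} (𝒜 : BoundaryAtlas D)
    {A : Type*} [CommRing A] [Algebra ℝ A] (V : Fin (p + 1) → E p → A) (i : Fin 𝒜.N) :
    EuclideanSpace ℝ (Fin p) → A :=
  (𝒜.chart i).pullback fun k y => 𝒜.χ i y • V k y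

/-- The integral over the boundary of `D`, oriented as the boundary of `D`, of the `A`-valued
`p`-form `(∑ V_k ∂/∂y_k) ⌟ dV` exists and is equal to `I`: there are atlases with subordinate
partitions of unity, and all of them give the value `I`. -/
def HasBoundaryIntegral {p : ℕ} {A : Type*} [CommRing A] [Algebra ℝ A]
    (e : Module.Basis (Fin (p + 1)) ℝ A) (D : Set (E p))
    (V : Fin (p + 1) → E p → A) (I : A) : Prop :=
  Nonempty (BoundaryAtlas D) ∧ ∀ 𝒜 : BoundaryAtlas D,
    (∀ i, MeasureTheory.Integrable (components e (𝒜.integrand V i))) ∧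
    ∑ i, e.equivFun.symm (∫ t, components e (𝒜.integrand V i) t) = I

/-! ### The Cauchy formula -/

section Formula

variable {p : ℕ} {A : Type*} [CommRing A] [Algebra ℝ A]

/-- The coefficients `a m j` of the Cauchy–Riemann equations `∑ j, (∂f/∂x_j) a m j = 0` that
express `A`-differentiability, namely `∂f/∂x_(m+1) - e_(m+1) ∂f/∂x_0 = 0` for `0 ≤ m < p`. -/
noncomputable def crCoeff (e : Module.Basis (Fin (p + 1)) ℝ A) (m : Fin p) (j : Fin (p + 1)) : A :=
  if j = 0 then -e m.succ else if j = m.succ then 1 else 0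

/-- The volume of the unit ball of `ℝ^(p+1)`. -/
noncomputable def ballVolume (p : ℕ) : ℝ :=
  (MeasureTheory.volume (Metric.ball (0 : E p) 1)).toReal

/-- The linear functions `φ_m(x, y) = ∑ i, b m i (y_i - x_i)`. -/
noncomputable def phi (b : Fin p → Fin (p + 1) → A) (m : Fin p) (x y : E p) : A :=
  ∑ i, (y i - x i) • b m i

/-- The equations on the coefficients of `φ_m` which say that the kernel
`‖y - x‖^(-n) ∑ m, (-1)^(i_m - 1) φ_m(x, y) dy_1 ∧ … (without dy_(i_m)) … ∧ dy_n`, with `n = p + 1`,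
is a fundamental solution of the Cauchy–Riemann operator with the coefficients `a`. -/
def IsFundamental (a b : Fin p → Fin (p + 1) → A) : Prop :=
  (∀ j, ∑ m, a m j * b m j = (1 / ((p + 1 : ℝ) * ballVolume p)) • (1 : A)) ∧
  ∀ i j, i ≠ j → ∑ m, (a m j * b m i + a m i * b m j) = 0

/-- The vector field `V` for which `(∑ V_k ∂/∂y_k) ⌟ dV` is
`f(y) ∑ m, (∑ k, a m k ∂/∂y_k) ⌟ (φ_m(x, y) ‖y - x‖^(-n) dV)`, with `n = p + 1`. -/
noncomputable def cauchyField (a b : Fin p → Fin (p + 1) → A) (f : E p → A) (x : E p)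
    (k : Fin (p + 1)) (y : E p) : A :=
  f y * ∑ m, a m k * ((‖y - x‖ ^ (p + 1))⁻¹ • phi b m x y)

/-- The `A`-differentiable functions satisfy a Cauchy formula: for some kernel, which depends only
on `A` and its basis, `f(x) = ∫_∂D f(y) ∑ m, (∑ k, a m k ∂/∂y_k) ⌟ (φ_m(x, y) ‖y - x‖^(-n) dV)`
at each point `x` of each bounded open set `D` with smooth boundary, for each `f` that is
continuous on the closure of `D` and `A`-differentiable in `D`. -/
def SatisfyCauchyFormula (e : Module.Basis (Fin (p + 1)) ℝ A) : Prop :=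
  ∃ b : Fin p → Fin (p + 1) → A, IsFundamental (crCoeff e) b ∧
    ∀ D : Set (E p), IsOpen D → Bornology.IsBounded D → HasSmoothBoundary D →
      ∀ f : E p → A, ContinuousOn (components e f) (closure D) → IsADifferentiableOn e f D →
        ∀ x ∈ D, HasBoundaryIntegral e D (cauchyField (crCoeff e) b f x) (f x)

end Formula

end AlgebraCauchy

/-! Write `c = 1/(n Vol)`, `K = aᵀb` and let `N = (y - x)‖y - x‖^(-n)` be the Newton field, so that
the Cauchy field is `V_k = f ∑ᵢ K_{ki} Nᵢ`. The equations on `b` say exactly that the symmetric part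
of `K` is `c` times the identity. They are solved by `b_m^0 = c e_m`, `b_m^m = c`, and zero
otherwise; the hypothesis `∑ e_m² = 0` is what gives `K_{00} = -c ∑_{m ≥ 1} e_m² = c`.

A symmetric real matrix paired with `K` sees only its own trace
(`IsFundamental.sum_smul_kernelCoeff`). This is used twice. The Jacobian matrix of `N` is symmetric
and trace-free, so derivatives falling on `N` contribute nothing to `div V`; those falling on `f`
cancel by the Cauchy–Riemann equations. Hence `V` is divergence-free off `x`. Secondly, the matrix
`(y_k - x_k) Nᵢ` gives the radial component `(y - x) · V = c ‖y - x‖^(2-n) f(y)`.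

The rest is Stokes with little regularity: `f` is merely differentiable inside and continuous up to
the boundary. The divergence theorem on boxes needs only pointwise differentiability inside,
continuity up to the faces and an integrable divergence. For a smooth cutoff `ψ`, `div (ψV) = ∇ψ ·
V` is continuous, although single partial derivatives of `V` may not be. Straightening charts and a
partition of unity turn the flux into `∫_D ∇η · V`, for any smooth `η` that is `1` on the boundary
and `0` near `x` (`IsSolenoidal.flux_eq`). For a radial `η` this is the average of `f` against a
nonnegative weight of mass one near `x`, which replaces the usual small sphere
(`IsSolenoidal.flux_eq_value`). -/

namespace AlgebraCauchy

open MeasureTheory Set Filter Topology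

/-! ### Straightening the boundary in a chart -/

namespace GraphChart

variable {p : ℕ} {D : Set (E p)} (c : GraphChart D)

/-- The coordinates of `z` other than the one that the chart solves for. -/
noncomputable def base (z : Fin (p + 1) → ℝ) : EuclideanSpace ℝ (Fin p) :=
  WithLp.toLp 2 fun i => z (c.j.succAbove i)

/-- The map that straightens the boundary: in the chart, `D` is the image of `0 < z_j`. -/
noncomputable def flat (z : Fin (p + 1) → ℝ) : E p :=
  WithLp.toLp 2 (c.j.insertNth (α := fun _ => ℝ) (c.γ (c.base z) + c.s * z c.j)
    fun i => z (c.j.succAbove i))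

/-- The inverse of `flat`. -/
noncomputable def unflat (y : E p) : Fin (p + 1) → ℝ :=
  c.j.insertNth (α := fun _ => ℝ) (c.s * (y c.j - c.γ (c.base y)))
    fun i => y (c.j.succAbove i)

lemma s_mul_s : c.s * c.s = 1 := by
  rcases c.sign_s with h | h <;> simp [h]

@[simp] lemma flat_apply_j (z : Fin (p + 1) → ℝ) :
    c.flat z c.j = c.γ (c.base z) + c.s * z c.j := by simp [flat]

@[simp] lemma flat_apply_succAbove (z : Fin (p + 1) → ℝ) (i : Fin p) :
    c.flat z (c.j.succAbove i) = z (c.j.succAbove i) := by simp [flat]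

@[simp] lemma base_flat (z : Fin (p + 1) → ℝ) : c.base (c.flat z) = c.base z := by
  simp [base]

lemma unflat_flat (z : Fin (p + 1) → ℝ) : c.unflat (c.flat z) = z := by
  ext k
  rcases Fin.eq_self_or_eq_succAbove c.j k with rfl | ⟨i, rfl⟩
  · simp [unflat, ← mul_assoc, c.s_mul_s]
  · simp [unflat]

lemma param_eq_flat (t : Fin p → ℝ) :
    c.param (WithLp.toLp 2 t) = c.flat (c.j.insertNth (α := fun _ => ℝ) 0 t) := by
  ext k
  rcases Fin.eq_self_or_eq_succAbove c.j k with rfl | ⟨i, rfl⟩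
  · simp [param, base]
  · simp [param]

lemma contDiff_base : ContDiff ℝ ∞ c.base := by
  rw [contDiff_euclidean]
  intro i
  exact contDiff_apply ℝ ℝ (c.j.succAbove i)

lemma contDiff_flat : ContDiff ℝ ∞ c.flat := by
  rw [contDiff_euclidean]
  intro k
  rcases Fin.eq_self_or_eq_succAbove c.j k with rfl | ⟨i, rfl⟩
  · simp only [flat_apply_j]
    exact (c.smooth_γ.comp c.contDiff_base).add (contDiff_const.mul (contDiff_apply ℝ ℝ c.j))
  · simp only [flat_apply_succAbove]
    exact contDiff_apply ℝ ℝ (c.j.succAbove i)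

lemma continuous_unflat : Continuous c.unflat := by
  refine continuous_pi fun k => ?_
  rcases Fin.eq_self_or_eq_succAbove c.j k with rfl | ⟨i, rfl⟩
  · simp only [unflat, Fin.insertNth_apply_same]
    have : Continuous fun y : E p => c.base y := by
      unfold base; fun_prop
    have := c.smooth_γ.continuous.comp this
    fun_prop
  · simp only [unflat, Fin.insertNth_apply_succAbove]
    fun_prop

lemma fderiv_flat_apply (z v : Fin (p + 1) → ℝ) (k : Fin (p + 1)) :
    fderiv ℝ c.flat z v k = fderiv ℝ (fun w => c.flat w k) z v := by
  have h := (c.contDiff_flat.differentiable (by simp)) z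
  have := ((EuclideanSpace.proj (𝕜 := ℝ) k).hasFDerivAt.comp z h.hasFDerivAt).fderiv
  exact (congrArg (fun L => L v) this).symm

lemma fderiv_base_apply (z v : Fin (p + 1) → ℝ) : fderiv ℝ c.base z v = c.base v := by
  ext i
  have h := (c.contDiff_base.differentiable (by simp)) z
  have := ((EuclideanSpace.proj (𝕜 := ℝ) i).hasFDerivAt.comp z h.hasFDerivAt).fderiv
  have h2 := (congrArg (fun L => L v) this).symm
  refine h2.trans ?_
  have h3 : (EuclideanSpace.proj (𝕜 := ℝ) i ∘ c.base : (Fin (p + 1) → ℝ) → ℝ)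
      = ContinuousLinearMap.proj (R := ℝ) (φ := fun _ => ℝ) (c.j.succAbove i) := rfl
  rw [h3, ContinuousLinearMap.fderiv]
  rfl

lemma fderiv_flat_apply_j (z v : Fin (p + 1) → ℝ) :
    fderiv ℝ c.flat z v c.j = fderiv ℝ c.γ (c.base z) (c.base v) + c.s * v c.j := by
  rw [fderiv_flat_apply]
  simp only [flat_apply_j]
  have h1 := (c.contDiff_base.differentiable (by simp)) z
  have h2 := (c.smooth_γ.differentiable (by simp)) (c.base z)
  have h3 : HasFDerivAt (fun w : Fin (p + 1) → ℝ => w c.j) _ z :=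
    (ContinuousLinearMap.proj (R := ℝ) (φ := fun _ => ℝ) c.j).hasFDerivAt
  have := ((h2.hasFDerivAt.comp z h1.hasFDerivAt).add (h3.const_mul c.s)).fderiv
  refine (congrArg (fun L => L v) this).trans ?_
  simp [fderiv_base_apply]

lemma fderiv_flat_apply_succAbove (z v : Fin (p + 1) → ℝ) (i : Fin p) :
    fderiv ℝ c.flat z v (c.j.succAbove i) = v (c.j.succAbove i) := by
  rw [fderiv_flat_apply]
  simp only [flat_apply_succAbove]
  have h3 : HasFDerivAt (fun w : Fin (p + 1) → ℝ => w (c.j.succAbove i)) _ z :=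
    (ContinuousLinearMap.proj (R := ℝ) (φ := fun _ => ℝ) (c.j.succAbove i)).hasFDerivAt
  exact congrArg (fun L => L v) h3.fderiv

lemma base_single_j : c.base (Pi.single c.j 1) = 0 := by
  ext i
  simp [base]

lemma base_single_succAbove (i : Fin p) :
    c.base (Pi.single (c.j.succAbove i) 1) = EuclideanSpace.single i 1 := by
  ext l
  by_cases h : l = i
  · subst h; simp [base]
  · simp [base, h]

lemma fderiv_flat_single_j (z : Fin (p + 1) → ℝ) :
    fderiv ℝ c.flat z (Pi.single c.j 1) = c.s • EuclideanSpace.single c.j 1 := by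
  ext k
  rcases Fin.eq_self_or_eq_succAbove c.j k with rfl | ⟨i, rfl⟩
  · rw [fderiv_flat_apply_j, base_single_j]; simp
  · rw [fderiv_flat_apply_succAbove]; simp

lemma fderiv_flat_single_succAbove (z : Fin (p + 1) → ℝ) (i : Fin p) :
    fderiv ℝ c.flat z (Pi.single (c.j.succAbove i) 1) =
      EuclideanSpace.single (c.j.succAbove i) 1 +
        fderiv ℝ c.γ (c.base z) (EuclideanSpace.single i 1) • EuclideanSpace.single c.j 1 := by
  ext k
  rcases Fin.eq_self_or_eq_succAbove c.j k with rfl | ⟨l, rfl⟩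
  · rw [fderiv_flat_apply_j, base_single_succAbove]; simp
  · rw [fderiv_flat_apply_succAbove]
    by_cases h : l = i
    · subst h; simp
    · simp [h]

/-- With the other coordinates fixed, the map is `u ↦ γ + s u`, a reflection or the identity
followed by a translation. So this is a skew product and no Jacobian determinant is needed. -/
lemma measurePreserving_flat : MeasurePreserving c.flat := by
  have h1 := volume_preserving_piFinSuccAbove (fun _ : Fin (p + 1) => ℝ) c.j
  have h2 : MeasurePreserving
      (fun q : (Fin p → ℝ) × ℝ => (id q.1, c.γ (WithLp.toLp 2 q.1) + c.s * q.2)) := by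
    refine MeasurePreserving.skew_product (f := id)
      (g := fun (a : Fin p → ℝ) (u : ℝ) => c.γ (WithLp.toLp 2 a) + c.s * u)
      (MeasurePreserving.id _) ?_ (ae_of_all _ fun a => ?_)
    · have := c.smooth_γ.continuous
      refine Continuous.measurable ?_
      unfold Function.uncurry
      fun_prop
    · have h3 : MeasurePreserving (fun u : ℝ => c.s * u) := by
        rcases c.sign_s with h | h
        · simp only [h, one_mul]; exact MeasurePreserving.id volume
        · simpa [h] using Measure.measurePreserving_neg (volume : Measure ℝ)
      exact ((measurePreserving_add_left volume (c.γ (WithLp.toLp 2 a))).comp h3).map_eq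
  have h3 := (PiLp.volume_preserving_toLp (Fin (p + 1))).comp
    (h1.symm.comp (Measure.measurePreserving_swap.comp
      (h2.comp (Measure.measurePreserving_swap.comp h1))))
  exact h3

lemma mem_of_flat {z : Fin (p + 1) → ℝ} (hz : c.flat z ∈ c.U) : c.flat z ∈ D ↔ 0 < z c.j := by
  have h1 : (WithLp.toLp 2 fun i => c.flat z (c.j.succAbove i)) = c.base z := by simp [base]
  rw [c.mem_iff _ hz, h1, flat_apply_j, add_sub_cancel_left, ← mul_assoc, c.s_mul_s, one_mul]

lemma mem_closure_of_flat {z : Fin (p + 1) → ℝ} (hz : c.flat z ∈ c.U) (h0 : 0 ≤ z c.j) :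
    c.flat z ∈ closure D := by
  have hc : Continuous fun h : ℝ => c.flat (z + h • Pi.single c.j 1) :=
    c.contDiff_flat.continuous.comp (by fun_prop)
  have h1 : Tendsto (fun h : ℝ => c.flat (z + h • Pi.single c.j 1)) (𝓝[>] 0) (𝓝 (c.flat z)) := by
    have := hc.tendsto 0
    simp only [zero_smul, add_zero] at this
    exact this.mono_left nhdsWithin_le_nhds
  refine mem_closure_of_tendsto h1 ?_
  filter_upwards [h1.eventually (c.isOpen_U.mem_nhds hz), self_mem_nhdsWithin] with h hh h2
  rw [c.mem_of_flat hh]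
  simpa using add_pos_of_nonneg_of_pos h0 h2

/-- The graph of `γ` bounds `D` only inside `U`. This lets identities known on the frontier be used
under the chart integrals, since the partition functions vanish on the rest of the graph. -/
lemma param_mem_frontier (hD : IsOpen D) {t : EuclideanSpace ℝ (Fin p)} (ht : c.param t ∈ c.U) :
    c.param t ∈ frontier D := by
  have h := c.param_eq_flat t.ofLp
  rw [WithLp.toLp_ofLp] at h
  rw [h] at ht ⊢
  rw [hD.frontier_eq]
  exact ⟨c.mem_closure_of_flat ht (by simp), fun h => by simpa using (c.mem_of_flat ht).1 h⟩

end GraphChart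
end AlgebraCauchy

/-! ### The divergence theorem in a chart -/

namespace AlgebraCauchy

open MeasureTheory Set Filter Topology

namespace GraphChart

variable {p : ℕ} {D : Set (E p)} (c : GraphChart D)
variable {W : Type*} [NormedAddCommGroup W]

/-- The half-space is mapped into the closure of `D` only within `U`; elsewhere continuity holds
because `G` vanishes near any point off the closed set `S`. -/
lemma continuousOn_comp_flat {S : Set (E p)} (hS : IsClosed S) (hSU : S ⊆ c.U) {G : E p → W}
    (hG : ContinuousOn G (closure D)) (hGS : ∀ y ∉ S, G y = 0) :
    ContinuousOn (fun z => G (c.flat z)) {z | 0 ≤ z c.j} := by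
  intro z hz
  have hF := c.contDiff_flat.continuous
  by_cases h : c.flat z ∈ S
  · have h1 : c.flat ⁻¹' c.U ∈ 𝓝 z := (c.isOpen_U.preimage hF).mem_nhds (hSU h)
    rw [← continuousWithinAt_inter h1]
    refine ContinuousWithinAt.comp (hG _ (c.mem_closure_of_flat (hSU h) hz))
      hF.continuousWithinAt ?_
    exact fun w hw => c.mem_closure_of_flat hw.2 hw.1
  · refine ContinuousAt.continuousWithinAt ?_
    refine (continuousAt_const (y := (0 : W))).congr ?_
    filter_upwards [(hS.isOpen_compl.preimage hF).mem_nhds h] with w hw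
    exact (hGS _ hw).symm

variable [NormedSpace ℝ W]

lemma contDiff_outwardNormal (k : Fin (p + 1)) : ContDiff ℝ ∞ fun t => c.outwardNormal t k := by
  rcases Fin.eq_self_or_eq_succAbove c.j k with rfl | ⟨i, rfl⟩
  · simp only [outwardNormal, Fin.insertNth_apply_same]
    exact contDiff_const
  · simp only [outwardNormal, Fin.insertNth_apply_succAbove]
    exact contDiff_const.mul ((c.smooth_γ.fderiv_right (by simp)).clm_apply contDiff_const)

/-- The Piola transform of the vector field `G` under `flat`. -/
noncomputable def piola (G : Fin (p + 1) → E p → W) (k : Fin (p + 1)) (z : Fin (p + 1) → ℝ) : W :=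
  if k = c.j then -∑ l, c.outwardNormal (c.base z) l • G l (c.flat z) else G k (c.flat z)

lemma differentiableAt_piola {G : Fin (p + 1) → E p → W} {z : Fin (p + 1) → ℝ}
    (hG : ∀ k, DifferentiableAt ℝ (G k) (c.flat z)) (k : Fin (p + 1)) :
    DifferentiableAt ℝ (c.piola G k) z := by
  have hF := (c.contDiff_flat.differentiable (by simp)) z
  have hB := (c.contDiff_base.differentiable (by simp)) z
  have h1 : ∀ k, DifferentiableAt ℝ (fun z => G k (c.flat z)) z := fun k => (hG k).comp z hF
  unfold piola
  split_ifs
  · refine (DifferentiableAt.fun_sum fun l _ => ?_).neg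
    have h2 := (((c.contDiff_outwardNormal l).differentiable (by simp)) (c.base z)).comp z hB
    exact h2.smul (h1 l)
  · exact h1 k

/-- `piola G` is the inverse Jacobian matrix of `flat` applied to `G ∘ flat`, and the determinant is
the constant `±1`. The terms `∂ᵢγ ∂ⱼGᵢ` coming from the tangential components cancel those in the
`j`-th one. No second derivative of `γ` appears, because the normal does not depend on `z_j`. -/
lemma sum_fderiv_piola {G : Fin (p + 1) → E p → W} {z : Fin (p + 1) → ℝ}
    (hG : ∀ k, DifferentiableAt ℝ (G k) (c.flat z)) :
    ∑ k, fderiv ℝ (c.piola G k) z (Pi.single k 1) =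
      ∑ k, fderiv ℝ (G k) (c.flat z) (EuclideanSpace.single k 1) := by
  have hF := (c.contDiff_flat.differentiable (by simp)) z
  have hB := (c.contDiff_base.differentiable (by simp)) z
  have h1 : ∀ k, HasFDerivAt (fun z => G k (c.flat z))
      ((fderiv ℝ (G k) (c.flat z)).comp (fderiv ℝ c.flat z)) z :=
    fun k => (hG k).hasFDerivAt.comp z hF.hasFDerivAt
  have hj : fderiv ℝ (c.piola G c.j) z (Pi.single c.j 1) =
      fderiv ℝ (G c.j) (c.flat z) (EuclideanSpace.single c.j 1) -
        ∑ i, fderiv ℝ c.γ (c.base z) (EuclideanSpace.single i 1) •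
          fderiv ℝ (G (c.j.succAbove i)) (c.flat z) (EuclideanSpace.single c.j 1) := by
    have h2 : ∀ l, HasFDerivAt (fun z => c.outwardNormal (c.base z) l)
        ((fderiv ℝ (fun t => c.outwardNormal t l) (c.base z)).comp (fderiv ℝ c.base z)) z :=
      fun l => (((c.contDiff_outwardNormal l).differentiable (by simp))
        (c.base z)).hasFDerivAt.comp z hB.hasFDerivAt
    have h3 : c.piola G c.j = fun z => -∑ l, c.outwardNormal (c.base z) l • G l (c.flat z) := by
      funext w; simp [piola]
    have h4 := (HasFDerivAt.fun_sum (u := Finset.univ) fun l _ => (h2 l).fun_smul (h1 l)).fun_neg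
    have hs := c.s_mul_s
    rw [h3, h4.fderiv]
    simp only [_root_.neg_apply, _root_.sum_apply,
      _root_.add_apply, _root_.smul_apply,
      ContinuousLinearMap.smulRight_apply, ContinuousLinearMap.comp_apply, fderiv_base_apply,
      base_single_j, map_zero, zero_smul, add_zero, fderiv_flat_single_j, map_smul]
    rw [Fin.sum_univ_succAbove _ c.j]
    simp only [outwardNormal, Fin.insertNth_apply_same, Fin.insertNth_apply_succAbove, smul_smul]
    have h5 : ∀ a : ℝ, c.s * a * c.s = a := fun a => by
      rw [mul_right_comm, hs, one_mul]
    simp only [h5, neg_mul, hs, neg_smul, one_smul]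
    abel
  rw [Fin.sum_univ_succAbove _ c.j, hj, Fin.sum_univ_succAbove _ c.j, sub_add,
    ← Finset.sum_sub_distrib]
  have hi : ∀ i, fderiv ℝ (c.piola G (c.j.succAbove i)) z (Pi.single (c.j.succAbove i) 1) =
      fderiv ℝ (G (c.j.succAbove i)) (c.flat z) (EuclideanSpace.single (c.j.succAbove i) 1) +
        fderiv ℝ c.γ (c.base z) (EuclideanSpace.single i 1) •
          fderiv ℝ (G (c.j.succAbove i)) (c.flat z) (EuclideanSpace.single c.j 1) := by
    intro i
    have h3 : c.piola G (c.j.succAbove i) = fun z => G (c.j.succAbove i) (c.flat z) := by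
      funext w; simp [piola]
    rw [h3, (h1 _).fderiv]
    simp [fderiv_flat_single_succAbove]
  rw [sub_eq_add_neg, ← Finset.sum_neg_distrib]
  congr 1
  refine Finset.sum_congr rfl fun i _ => ?_
  rw [hi]
  abel

/-- The divergence theorem in a chart, for a vector field that is supported in the chart and
merely differentiable inside of the domain. -/
theorem integral_outwardNormal_smul (hD : IsOpen D) {S : Set (E p)} (hS : IsClosed S)
    (hSU : S ⊆ c.U) (hK : IsCompact (S ∩ closure D)) {G : Fin (p + 1) → E p → W} {q : E p → W}
    (hG : ∀ k, ContinuousOn (G k) (closure D)) (hq : ContinuousOn q (closure D))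
    (hGS : ∀ k, ∀ y ∉ S, G k y = 0) (hqS : ∀ y ∉ S, q y = 0)
    (hd : ∀ y ∈ D, ∀ k, DifferentiableAt ℝ (G k) y)
    (hdiv : ∀ y ∈ D, ∑ k, fderiv ℝ (G k) y (EuclideanSpace.single k 1) = q y) :
    Integrable (fun t => ∑ k, c.outwardNormal t k • G k (c.param t)) ∧
      ∫ t, ∑ k, c.outwardNormal t k • G k (c.param t) = ∫ y in D, q y := by
  -- In straightened coordinates the part of `S` over the half-space lies strictly inside the cube
  -- of half-side `R`.
  obtain ⟨R, hR⟩ : ∃ R : ℝ, 0 < R ∧ ∀ z, 0 ≤ z c.j → c.flat z ∈ S → ‖z‖ < R := by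
    obtain ⟨R, hR0, hR⟩ := (hK.image c.continuous_unflat).isBounded.exists_pos_norm_lt
    refine ⟨R, hR0, fun z hz hzS => hR z ?_⟩
    exact ⟨_, ⟨hzS, c.mem_closure_of_flat (hSU hzS) hz⟩, c.unflat_flat z⟩
  obtain ⟨hR0, hR⟩ := hR
  set H : Set (Fin (p + 1) → ℝ) := {z | 0 ≤ z c.j} with hH
  have hGc : ∀ k, ContinuousOn (fun z => G k (c.flat z)) H := fun k =>
    c.continuousOn_comp_flat hS hSU (hG k) (hGS k)
  have hqc : ContinuousOn (fun z => q (c.flat z)) H := c.continuousOn_comp_flat hS hSU hq hqS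
  have hF := c.contDiff_flat.continuous
  -- the boundary integrand
  set B : (Fin p → ℝ) → W := fun t =>
    ∑ k, c.outwardNormal (WithLp.toLp 2 t) k • G k (c.param (WithLp.toLp 2 t)) with hB
  have hBpiola : ∀ t, c.piola G c.j (c.j.insertNth (α := fun _ => ℝ) 0 t) = -B t := by
    intro t
    have h1 : c.base (c.j.insertNth (α := fun _ => ℝ) 0 t) = WithLp.toLp 2 t := by simp [base]
    simp [piola, hB, param_eq_flat, h1]
  have hB0 : ∀ t, R ≤ ‖t‖ → B t = 0 := by
    intro t ht
    refine Finset.sum_eq_zero fun k _ => ?_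
    rw [hGS, smul_zero]
    intro h
    rw [param_eq_flat] at h
    have h1 := hR _ (by simp) h
    refine absurd h1 (not_lt.2 (ht.trans ?_))
    refine (pi_norm_le_iff_of_nonneg (norm_nonneg _)).2 fun i => ?_
    have := norm_le_pi_norm (c.j.insertNth (α := fun _ => ℝ) 0 t) (c.j.succAbove i)
    simpa using this
  have hBc : Continuous B := by
    refine continuous_finsetSum _ fun k _ => ?_
    refine ((c.contDiff_outwardNormal k).continuous.comp (by fun_prop)).smul ?_
    simp only [param_eq_flat]
    have hins : Continuous fun t : Fin p → ℝ => c.j.insertNth (α := fun _ => ℝ) (0 : ℝ) t :=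
      Continuous.finInsertNth c.j continuous_const continuous_id
    exact ContinuousOn.comp_continuous (g := fun z => G k (c.flat z)) (hGc k) hins
      (fun t => by simp [hH])
  have hBi : Integrable B := by
    refine hBc.integrable_of_hasCompactSupport
      (HasCompactSupport.intro (isCompact_closedBall 0 R) fun t ht => hB0 t ?_)
    simpa using le_of_lt (not_le.1 (by simpa using ht))
  have hmp := PiLp.volume_preserving_toLp (Fin p)
  have hme : MeasurableEmbedding (WithLp.toLp 2 : (Fin p → ℝ) → EuclideanSpace ℝ (Fin p)) :=
    (MeasurableEquiv.toLp 2 (Fin p → ℝ)).measurableEmbedding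
  refine ⟨(hmp.integrable_comp_emb hme).1 hBi, ?_⟩
  rw [← hmp.integral_comp hme]
  change ∫ t, B t = _
  -- the box
  set a : Fin (p + 1) → ℝ := c.j.insertNth (α := fun _ => ℝ) 0 (fun _ => -R) with ha
  set b : Fin (p + 1) → ℝ := fun _ => R with hb
  have haj : a c.j = 0 := by simp [ha]
  have hai : ∀ i, a (c.j.succAbove i) = -R := by simp [ha]
  have hle : a ≤ b := by
    intro k
    rcases Fin.eq_self_or_eq_succAbove c.j k with rfl | ⟨i, rfl⟩
    · rw [haj]; exact hR0.le
    · rw [hai]; simp only [hb]; linarith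
  have hbox : Icc a b ⊆ H := fun z hz => by simpa [haj, hH] using hz.1 c.j
  have hin : ∀ z ∈ Set.pi univ fun i => Ioo (a i) (b i), 0 < z c.j := fun z hz => by
    simpa [haj] using (hz c.j (mem_univ _)).1
  -- Off `S` everything vanishes nearby, so `z_j > 0` suffices even where `flat z` has left `U` and
  -- need not lie in `D`.
  have hdiff : ∀ z, 0 < z c.j → (∀ k, DifferentiableAt ℝ (G k) (c.flat z)) ∧
      ∑ k, fderiv ℝ (G k) (c.flat z) (EuclideanSpace.single k 1) = q (c.flat z) := by
    intro z hz
    by_cases h : c.flat z ∈ S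
    · have := (c.mem_of_flat (hSU h)).2 hz
      exact ⟨hd _ this, hdiv _ this⟩
    · have h1 : ∀ k, G k =ᶠ[𝓝 (c.flat z)] fun _ => 0 := fun k => by
        filter_upwards [hS.isOpen_compl.mem_nhds h] with y hy using hGS k y hy
      refine ⟨fun k => (differentiableAt_const 0).congr_of_eventuallyEq (h1 k), ?_⟩
      simp [(h1 _).fderiv_eq, hqS _ h]
  have hWc : ∀ k, ContinuousOn (c.piola G k) (Icc a b) := by
    intro k
    unfold piola
    split_ifs
    · refine (continuousOn_finsetSum _ fun l _ => ?_).neg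
      exact ((c.contDiff_outwardNormal l).continuous.comp
        c.contDiff_base.continuous).continuousOn.smul ((hGc l).mono hbox)
    · exact (hGc k).mono hbox
  have hae : (Set.pi univ fun i => Ioo (a i) (b i)) =ᵐ[volume] Icc a b :=
    Measure.univ_pi_Ioo_ae_eq_Icc
  have hdivbox : ∀ z ∈ Set.pi univ fun i => Ioo (a i) (b i),
      ∑ k, fderiv ℝ (c.piola G k) z (Pi.single k 1) = q (c.flat z) := fun z hz => by
    rw [c.sum_fderiv_piola (hdiff z (hin z hz)).1, (hdiff z (hin z hz)).2]
  have hmeas : MeasurableSet (Set.pi univ fun i => Ioo (a i) (b i)) :=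
    MeasurableSet.univ_pi fun i => measurableSet_Ioo
  have hqi : IntegrableOn (fun z => q (c.flat z)) (Icc a b) :=
    (hqc.mono hbox).integrableOn_compact isCompact_Icc
  have hint : IntegrableOn (fun z => ∑ k, fderiv ℝ (c.piola G k) z (Pi.single k 1)) (Icc a b) := by
    rw [← integrableOn_congr_set_ae hae] at hqi ⊢
    exact hqi.congr_fun (fun z hz => (hdivbox z hz).symm) hmeas
  have key := integral_divergence_of_hasFDerivAt_off_countable' a b hle (c.piola G)
    (fun k z => fderiv ℝ (c.piola G k) z) ∅ countable_empty hWc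
    (fun z hz k => (c.differentiableAt_piola (hdiff z (hin z hz.1)).1 k).hasFDerivAt) hint
  rw [← setIntegral_congr_set hae, setIntegral_congr_fun hmeas hdivbox] at key
  -- the faces
  have hzero : ∀ k z, 0 ≤ z c.j → R ≤ ‖z‖ → c.piola G k z = 0 := by
    intro k z hz hzR
    have h1 : ∀ l, G l (c.flat z) = 0 := fun l => hGS l _ fun h => absurd (hR z hz h) (not_lt.2 hzR)
    simp [piola, h1]
  have hnorm : ∀ (k : Fin (p + 1)) (u : ℝ) (t : Fin p → ℝ), |u| = R →
      R ≤ ‖(k.insertNth (α := fun _ => ℝ) u t : Fin (p + 1) → ℝ)‖ := by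
    intro k u t hu
    have := norm_le_pi_norm (k.insertNth (α := fun _ => ℝ) u t) k
    simpa [hu] using this
  have habsR : |R| = R := abs_of_pos hR0
  have hfront : ∀ k, ∫ t in Icc (a ∘ k.succAbove) (b ∘ k.succAbove),
      c.piola G k (k.insertNth (α := fun _ => ℝ) (b k) t) = 0 := by
    intro k
    refine setIntegral_eq_zero_of_forall_eq_zero fun t ht => hzero _ _ ?_ (hnorm _ _ _ habsR)
    exact hbox ((Fin.insertNth_mem_Icc (α := fun _ => ℝ)).2 ⟨⟨hle k, le_rfl⟩, ht⟩)
  have hback : ∀ i, ∫ t in Icc (a ∘ (c.j.succAbove i).succAbove) (b ∘ (c.j.succAbove i).succAbove),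
      c.piola G (c.j.succAbove i)
        ((c.j.succAbove i).insertNth (α := fun _ => ℝ) (a (c.j.succAbove i)) t) = 0 := by
    intro i
    refine setIntegral_eq_zero_of_forall_eq_zero fun t ht => hzero _ _ ?_ (hnorm _ _ _ ?_)
    · exact hbox ((Fin.insertNth_mem_Icc (α := fun _ => ℝ)).2 ⟨⟨le_rfl, hle _⟩, ht⟩)
    · rw [hai, abs_neg, habsR]
  rw [Fin.sum_univ_succAbove _ c.j] at key
  simp only [hfront, hback, haj, hBpiola, sub_zero, Finset.sum_const_zero, add_zero, zero_sub,
    integral_neg, neg_neg] at key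
  have hface : ∫ t in Icc (a ∘ c.j.succAbove) (b ∘ c.j.succAbove), B t = ∫ t, B t := by
    refine setIntegral_eq_integral_of_forall_compl_eq_zero fun t ht => hB0 t ?_
    by_contra hlt
    refine ht ⟨fun i => ?_, fun i => ?_⟩ <;>
    have := (norm_le_pi_norm t i).trans (not_le.1 hlt).le <;>
    rw [Real.norm_eq_abs, abs_le] at this
    · simpa [hai] using this.1
    · exact this.2
  rw [hface] at key
  rw [← key]
  -- change of variables
  have hFe : MeasurableEmbedding c.flat :=
    MeasurableEmbedding.of_measurable_inverse hF.measurable ?_ c.continuous_unflat.measurable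
      c.unflat_flat
  swap
  · have : range c.flat = univ := by
      refine eq_univ_of_forall fun y => ⟨c.unflat y, ?_⟩
      ext k
      have hb : c.base (c.unflat y) = c.base y := by simp [base, unflat]
      rcases Fin.eq_self_or_eq_succAbove c.j k with rfl | ⟨i, rfl⟩
      · rw [flat_apply_j, hb]; simp [unflat, ← mul_assoc, c.s_mul_s]
      · simp [unflat]
    rw [this]; exact MeasurableSet.univ
  rw [← c.measurePreserving_flat.setIntegral_preimage_emb hFe q D]
  have hDm : MeasurableSet (c.flat ⁻¹' D) := hF.measurable hD.measurableSet
  rw [← integral_indicator hmeas, ← integral_indicator hDm]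
  congr 1
  funext z
  -- Over `S` the open box and the preimage of `D` coincide; off `S` the integrand is zero.
  by_cases hzS : c.flat z ∈ S
  · have hiff : z ∈ (Set.pi univ fun i => Ioo (a i) (b i)) ↔ z ∈ c.flat ⁻¹' D := by
      rw [mem_preimage, c.mem_of_flat (hSU hzS)]
      refine ⟨hin z, fun hz k _ => ?_⟩
      have h1 := (norm_le_pi_norm z k).trans_lt (hR z hz.le hzS)
      rw [Real.norm_eq_abs, abs_lt] at h1
      refine ⟨?_, h1.2⟩
      rcases Fin.eq_self_or_eq_succAbove c.j k with rfl | ⟨i, rfl⟩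
      · rw [haj]; exact hz
      · rw [hai]; exact h1.1
    by_cases hz : z ∈ c.flat ⁻¹' D
    · rw [indicator_of_mem hz, indicator_of_mem (hiff.2 hz)]
    · rw [indicator_of_notMem hz, indicator_of_notMem (mt hiff.1 hz)]
  · have := hqS _ hzS
    simp [indicator, this]

end GraphChart
end AlgebraCauchy

/-! ### Flux of a solenoidal field through the whole boundary -/

namespace AlgebraCauchy

open MeasureTheory Set Filter Topology

variable {p : ℕ} {D O : Set (E p)} {W : Type*} [NormedAddCommGroup W] [NormedSpace ℝ W]

/-- `∇ψ · V`. -/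
noncomputable def gradDot (ψ : E p → ℝ) (V : Fin (p + 1) → E p → W) (y : E p) : W :=
  ∑ k, fderiv ℝ ψ y (EuclideanSpace.single k 1) • V k y

/-- On the open set `O`, the vector field `V` is continuous up to the boundary of `D`, and it is
differentiable and free of divergence inside of `D`. -/
structure IsSolenoidal (V : Fin (p + 1) → E p → W) (D O : Set (E p)) : Prop where
  continuousOn : ∀ k, ContinuousOn (V k) (closure D ∩ O)
  differentiableAt : ∀ y ∈ D ∩ O, ∀ k, DifferentiableAt ℝ (V k) y
  div_eq_zero : ∀ y ∈ D ∩ O, ∑ k, fderiv ℝ (V k) y (EuclideanSpace.single k 1) = 0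

lemma continuousOn_smul_of_tsupport_subset (hO : IsOpen O) {K : Set (E p)} {g : E p → ℝ}
    (hg : Continuous g) (hgO : tsupport g ⊆ O) {v : E p → W} (hv : ContinuousOn v (K ∩ O)) :
    ContinuousOn (fun y => g y • v y) K := by
  intro y hy
  by_cases h : y ∈ tsupport g
  · have h1 : O ∈ 𝓝 y := hO.mem_nhds (hgO h)
    rw [← continuousWithinAt_inter h1]
    exact hg.continuousWithinAt.smul (hv y ⟨hy, hgO h⟩)
  · refine ContinuousAt.continuousWithinAt ((continuousAt_const (y := (0 : W))).congr ?_)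
    filter_upwards [(isClosed_tsupport g).isOpen_compl.mem_nhds h] with w hw
    rw [image_eq_zero_of_notMem_tsupport hw, zero_smul]

lemma continuous_fderiv_apply {ψ : E p → ℝ} (hψ : ContDiff ℝ ∞ ψ) (v : E p) :
    Continuous fun y => fderiv ℝ ψ y v :=
  (hψ.continuous_fderiv (by simp)).clm_apply continuous_const

lemma gradDot_eq_zero {ψ : E p → ℝ} {V : Fin (p + 1) → E p → W} {y : E p}
    (hy : y ∉ tsupport ψ) : gradDot ψ V y = 0 := by
  have : fderiv ℝ ψ y = 0 := by
    by_contra h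
    exact hy (support_fderiv_subset ℝ h)
  simp [gradDot, this]

lemma IsSolenoidal.continuousOn_gradDot {V : Fin (p + 1) → E p → W} (hV : IsSolenoidal V D O)
    (hO : IsOpen O) {ψ : E p → ℝ} (hψ : ContDiff ℝ ∞ ψ) (hψO : tsupport ψ ⊆ O) :
    ContinuousOn (gradDot ψ V) (closure D) := by
  refine continuousOn_finsetSum _ fun k _ => ?_
  exact continuousOn_smul_of_tsupport_subset hO (continuous_fderiv_apply hψ _)
    ((tsupport_fderiv_apply_subset ℝ _).trans hψO) (hV.continuousOn k)

lemma IsSolenoidal.integrableOn_gradDot {V : Fin (p + 1) → E p → W} (hV : IsSolenoidal V D O)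
    (hO : IsOpen O) (hb : Bornology.IsBounded D) {ψ : E p → ℝ} (hψ : ContDiff ℝ ∞ ψ)
    (hψO : tsupport ψ ⊆ O) : IntegrableOn (gradDot ψ V) D :=
  ((hV.continuousOn_gradDot hO hψ hψO).integrableOn_compact hb.isCompact_closure).mono_set
    subset_closure

/-- Integration by parts in a chart. -/
theorem IsSolenoidal.integral_chart {V : Fin (p + 1) → E p → W} (hV : IsSolenoidal V D O)
    (hD : IsOpen D) (hO : IsOpen O) (c : GraphChart D) {ψ : E p → ℝ} (hψ : ContDiff ℝ ∞ ψ)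
    (hψU : tsupport ψ ⊆ c.U) (hψO : tsupport ψ ⊆ O) (hK : IsCompact (tsupport ψ ∩ closure D)) :
    Integrable (fun t => ∑ k, c.outwardNormal t k • ψ (c.param t) • V k (c.param t)) ∧
      ∫ t, ∑ k, c.outwardNormal t k • ψ (c.param t) • V k (c.param t) = ∫ y in D, gradDot ψ V y := by
  have hz : ∀ k, ∀ y ∉ tsupport ψ, (fun y => ψ y • V k y) =ᶠ[𝓝 y] fun _ => 0 := fun k y hy => by
    filter_upwards [(isClosed_tsupport ψ).isOpen_compl.mem_nhds hy] with w hw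
    rw [image_eq_zero_of_notMem_tsupport hw, zero_smul]
  have hsm : ∀ y ∈ D, y ∈ tsupport ψ → ∀ k, HasFDerivAt (fun y => ψ y • V k y)
      (ψ y • fderiv ℝ (V k) y + (fderiv ℝ ψ y).smulRight (V k y)) y := fun y hy h k =>
    ((hψ.differentiable (by simp)) y).hasFDerivAt.fun_smul
      (hV.differentiableAt y ⟨hy, hψO h⟩ k).hasFDerivAt
  refine c.integral_outwardNormal_smul (G := fun k y => ψ y • V k y) hD (isClosed_tsupport ψ) hψU hK
    (fun k => continuousOn_smul_of_tsupport_subset hO hψ.continuous hψO (hV.continuousOn k))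
    (hV.continuousOn_gradDot hO hψ hψO) (fun k y hy => (hz k y hy).eq_of_nhds)
    (fun y hy => gradDot_eq_zero hy) (fun y hy k => ?_) (fun y hy => ?_)
  · by_cases h : y ∈ tsupport ψ
    · exact (hsm y hy h k).differentiableAt
    · exact (differentiableAt_const 0).congr_of_eventuallyEq (hz k y h)
  · by_cases h : y ∈ tsupport ψ
    · simp only [(hsm y hy h _).fderiv, _root_.add_apply, _root_.smul_apply,
        ContinuousLinearMap.smulRight_apply, Finset.sum_add_distrib, ← Finset.smul_sum,
        hV.div_eq_zero y ⟨hy, hψO h⟩, smul_zero, zero_add, gradDot]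
    · simp [(hz _ y h).fderiv_eq, gradDot_eq_zero h]

/-- A half-space, as a domain with a chart. -/
noncomputable def halfSpaceChart (p : ℕ) (M : ℝ) : GraphChart {y : E p | M < y 0} where
  U := univ
  isOpen_U := isOpen_univ
  j := 0
  s := 1
  sign_s := Or.inl rfl
  γ := fun _ => M
  smooth_γ := contDiff_const
  mem_iff := fun y _ => by simp

/-- Nothing crosses the boundary when the support lies inside `D`. To reuse the chart theorem, `D`
is replaced by a half-space containing it, whose single global chart has a boundary that misses the
support. -/
theorem IsSolenoidal.integral_gradDot_interior {V : Fin (p + 1) → E p → W}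
    (hV : IsSolenoidal V D O) (hD : IsOpen D) (hO : IsOpen O) (hb : Bornology.IsBounded D)
    {ψ : E p → ℝ} (hψ : ContDiff ℝ ∞ ψ) (hψD : tsupport ψ ⊆ D) (hψO : tsupport ψ ⊆ O) :
    ∫ y in D, gradDot ψ V y = 0 := by
  obtain ⟨R, -, hR⟩ := hb.exists_pos_norm_lt
  have hRD : ∀ y ∈ D, -R < y 0 := fun y hy => by
    have := (PiLp.norm_apply_le y 0).trans_lt (hR y hy)
    rw [Real.norm_eq_abs, abs_lt] at this
    exact this.1
  set D' : Set (E p) := {y | -R < y 0} with hD'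
  have hD'o : IsOpen D' := isOpen_lt continuous_const (by fun_prop)
  have hV' : IsSolenoidal V D' (D ∩ O) :=
    ⟨fun k y hy => ((hV.differentiableAt y hy.2 k).continuousAt).continuousWithinAt,
      fun y hy => hV.differentiableAt y hy.2, fun y hy => hV.div_eq_zero y hy.2⟩
  have hK : IsCompact (tsupport ψ ∩ closure D') :=
    (Metric.isCompact_of_isClosed_isBounded (isClosed_tsupport ψ) (hb.subset hψD)).inter_right
      isClosed_closure
  have key := (hV'.integral_chart hD'o (hD.inter hO) (halfSpaceChart p (-R)) hψ (subset_univ _)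
    (subset_inter hψD hψO) hK).2
  have h0 : ∀ t, ψ ((halfSpaceChart p (-R)).param t) = 0 := fun t => by
    refine image_eq_zero_of_notMem_tsupport fun h => ?_
    have := hRD _ (hψD h)
    simp [halfSpaceChart, GraphChart.param] at this
  simp only [h0, zero_smul, smul_zero, Finset.sum_const_zero, integral_zero] at key
  rw [key]
  refine (setIntegral_eq_of_subset_of_forall_sdiff_eq_zero hD'o.measurableSet hRD
    fun y hy => ?_).symm
  exact gradDot_eq_zero fun h => hy.2 (hψD h)

/-- A partition of unity near the closure of a bounded domain with smooth boundary. -/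
theorem exists_partition (hD : IsOpen D) (hb : Bornology.IsBounded D) (hs : HasSmoothBoundary D) :
    ∃ (𝒜 : BoundaryAtlas D) (ρ : E p → ℝ), ContDiff ℝ ∞ ρ ∧ tsupport ρ ⊆ D ∧
      ∀ y ∈ closure D, ρ y + ∑ i, 𝒜.χ i y = 1 := by
  have hcomp : IsCompact (frontier D) := hb.isCompact_closure.of_isClosed_subset isClosed_frontier
    frontier_subset_closure
  choose ch hch using hs
  obtain ⟨T, hT⟩ := hcomp.elim_finite_subcover (fun a : frontier D => (ch a a.2).U)
    (fun a => (ch a a.2).isOpen_U) (fun a ha => mem_iUnion.2 ⟨⟨a, ha⟩, hch a ha⟩)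
  let N := Fintype.card T
  let en : Fin N ≃ T := (Fintype.equivFin T).symm
  let chart : Fin N → GraphChart D := fun i => ch (en i).1 (en i).1.2
  -- The index `none` stands for `D` itself. Its function is supported in the open set `D`, so it
  -- vanishes on the frontier and the chart functions alone sum to `1` there.
  let U : Option (Fin N) → Set (E p) := fun o => o.elim D fun i => (chart i).U
  have hcov : closure D ⊆ ⋃ o, U o := by
    intro y hy
    by_cases h : y ∈ D
    · exact mem_iUnion.2 ⟨none, h⟩
    · have hyf : y ∈ frontier D := by rw [hD.frontier_eq]; exact ⟨hy, h⟩
      obtain ⟨a, haT, ha⟩ := mem_iUnion₂.1 (hT hyf)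
      refine mem_iUnion.2 ⟨some (en.symm ⟨a, haT⟩), ?_⟩
      simpa [U, chart] using ha
  obtain ⟨f, hf⟩ := SmoothPartitionOfUnity.exists_isSubordinate (modelWithCornersSelf ℝ (E p))
    isClosed_closure U (by
      intro o
      cases o with
      | none => exact hD
      | some i => exact (chart i).isOpen_U) hcov
  have hsum : ∀ y ∈ closure D, f none y + ∑ i, f (some i) y = 1 := fun y hy => by
    rw [← f.sum_eq_one hy, finsum_eq_sum_of_fintype, Fintype.sum_option]
  refine ⟨⟨N, chart, fun i => f (some i), fun i => (f (some i)).contMDiff.contDiff,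
    fun i y => f.nonneg _ _, fun i => hf (some i), fun y hy => ?_⟩, f none,
    (f none).contMDiff.contDiff, hf none, hsum⟩
  have h1 := hsum y (frontier_subset_closure hy)
  have h2 : f none y = 0 := image_eq_zero_of_notMem_tsupport fun h => by
    rw [hD.frontier_eq] at hy
    exact hy.2 (hf none h)
  rwa [h2, zero_add] at h1

lemma gradDot_sum {ι : Type*} (s : Finset ι) {ψ : ι → E p → ℝ}
    {y : E p} (h : ∀ i ∈ s, DifferentiableAt ℝ (ψ i) y) (V : Fin (p + 1) → E p → W) :
    gradDot (fun z => ∑ i ∈ s, ψ i z) V y = ∑ i ∈ s, gradDot (ψ i) V y := by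
  unfold gradDot
  rw [fderiv_fun_sum h, Finset.sum_comm]
  simp only [_root_.sum_apply, Finset.sum_smul]

lemma gradDot_congr {ψ φ : E p → ℝ} {y : E p} (h : ψ =ᶠ[𝓝 y] φ) (V : Fin (p + 1) → E p → W) :
    gradDot ψ V y = gradDot φ V y := by
  simp [gradDot, h.fderiv_eq]

lemma gradDot_add {ψ φ : E p → ℝ} {y : E p} (hψ : DifferentiableAt ℝ ψ y)
    (hφ : DifferentiableAt ℝ φ y) (V : Fin (p + 1) → E p → W) :
    gradDot (fun z => ψ z + φ z) V y = gradDot ψ V y + gradDot φ V y := by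
  simp [gradDot, fderiv_fun_add hψ hφ, add_smul, Finset.sum_add_distrib]

/-- After localizing `ψ`, the interior piece integrates to zero and each chart piece equals a
boundary integral whose integrand contains the factor `ψ = 0`. -/
theorem IsSolenoidal.integral_gradDot_eq_zero {V : Fin (p + 1) → E p → W}
    (hV : IsSolenoidal V D O) (hD : IsOpen D) (hO : IsOpen O) (hb : Bornology.IsBounded D)
    (hs : HasSmoothBoundary D) {ψ : E p → ℝ} (hψ : ContDiff ℝ ∞ ψ) (hψO : tsupport ψ ⊆ O)
    (hψ0 : ∀ y ∈ frontier D, ψ y = 0) : ∫ y in D, gradDot ψ V y = 0 := by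
  obtain ⟨𝒜, ρ, hρ, hρD, hsum⟩ := exists_partition hD hb hs
  have hsub : ∀ g : E p → ℝ, tsupport (fun y => g y * ψ y) ⊆ O := fun g =>
    (tsupport_mul_subset_right (f := g) (g := ψ)).trans hψO
  have hsm0 : ContDiff ℝ ∞ fun y => ρ y * ψ y := hρ.mul hψ
  have hsmi : ∀ i, ContDiff ℝ ∞ fun y => 𝒜.χ i y * ψ y := fun i => (𝒜.smooth_χ i).mul hψ
  have h1 : ∀ y ∈ D, gradDot ψ V y =
      gradDot (fun y => ρ y * ψ y) V y + ∑ i, gradDot (fun y => 𝒜.χ i y * ψ y) V y := by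
    intro y hy
    rw [← gradDot_sum _ (fun i _ => (hsmi i).differentiable (by simp) y),
      ← gradDot_add (hsm0.differentiable (by simp) y)
        ((ContDiff.sum fun i _ => hsmi i).differentiable (by simp) y)]
    refine gradDot_congr ?_ V
    filter_upwards [hD.mem_nhds hy] with z hz
    rw [← Finset.sum_mul, ← add_mul, hsum z (subset_closure hz), one_mul]
  rw [setIntegral_congr_fun hD.measurableSet h1, integral_add
    (hV.integrableOn_gradDot hO hb hsm0 (hsub _))
    (integrable_finsetSum _ fun i _ => hV.integrableOn_gradDot hO hb (hsmi i) (hsub _)),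
    integral_finsetSum _ fun i _ => hV.integrableOn_gradDot hO hb (hsmi i) (hsub _),
    hV.integral_gradDot_interior hD hO hb hsm0
      ((tsupport_mul_subset_left (f := ρ) (g := ψ)).trans hρD) (hsub _), zero_add]
  refine Finset.sum_eq_zero fun i _ => ?_
  have hU : tsupport (fun y => 𝒜.χ i y * ψ y) ⊆ (𝒜.chart i).U :=
    (tsupport_mul_subset_left (f := 𝒜.χ i) (g := ψ)).trans (𝒜.support_χ i)
  rw [← (hV.integral_chart hD hO (𝒜.chart i) (hsmi i) hU (hsub _)
    (hb.isCompact_closure.inter_left (isClosed_tsupport _))).2]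
  refine integral_eq_zero_of_ae (ae_of_all _ fun t => ?_)
  have : 𝒜.χ i ((𝒜.chart i).param t) * ψ ((𝒜.chart i).param t) = 0 := by
    by_cases h : (𝒜.chart i).param t ∈ (𝒜.chart i).U
    · rw [hψ0 _ ((𝒜.chart i).param_mem_frontier hD h), mul_zero]
    · rw [image_eq_zero_of_notMem_tsupport fun h' => h (𝒜.support_χ i h'), zero_mul]
  simp [this]

/-- The flux of a solenoidal field through the boundary, computed with any atlas, is the
integral of `∇η · V` over the domain, where `η` is a cutoff function that is `1` on the boundary. -/
theorem IsSolenoidal.flux_eq {V : Fin (p + 1) → E p → W}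
    (hV : IsSolenoidal V D O) (hD : IsOpen D) (hO : IsOpen O) (hb : Bornology.IsBounded D)
    (hs : HasSmoothBoundary D) {η : E p → ℝ} (hη : ContDiff ℝ ∞ η) (hηO : tsupport η ⊆ O)
    (hη1 : ∀ y ∈ frontier D, η y = 1) (𝒜 : BoundaryAtlas D) :
    (∀ i, Integrable fun t => ∑ k, (𝒜.chart i).outwardNormal t k •
      𝒜.χ i ((𝒜.chart i).param t) • V k ((𝒜.chart i).param t)) ∧
    ∑ i, ∫ t, ∑ k, (𝒜.chart i).outwardNormal t k •
      𝒜.χ i ((𝒜.chart i).param t) • V k ((𝒜.chart i).param t) = ∫ y in D, gradDot η V y := by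
  have hsub : ∀ g : E p → ℝ, tsupport (fun y => g y * η y) ⊆ O := fun g =>
    (tsupport_mul_subset_right (f := g) (g := η)).trans hηO
  have hsmi : ∀ i, ContDiff ℝ ∞ fun y => 𝒜.χ i y * η y := fun i => (𝒜.smooth_χ i).mul hη
  have hU : ∀ i, tsupport (fun y => 𝒜.χ i y * η y) ⊆ (𝒜.chart i).U := fun i =>
    (tsupport_mul_subset_left (f := 𝒜.χ i) (g := η)).trans (𝒜.support_χ i)
  -- Multiplying by `η` leaves the boundary integrand unchanged and moves the support away from the
  -- points where `V` is uncontrolled.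
  have hval : ∀ i t, 𝒜.χ i ((𝒜.chart i).param t) =
      𝒜.χ i ((𝒜.chart i).param t) * η ((𝒜.chart i).param t) := fun i t => by
    by_cases h : (𝒜.chart i).param t ∈ (𝒜.chart i).U
    · rw [hη1 _ ((𝒜.chart i).param_mem_frontier hD h), mul_one]
    · rw [image_eq_zero_of_notMem_tsupport fun h' => h (𝒜.support_χ i h'), zero_mul]
  have key := fun i => hV.integral_chart hD hO (𝒜.chart i) (hsmi i) (hU i) (hsub _)
    (hb.isCompact_closure.inter_left (isClosed_tsupport _))
  simp only [← hval] at key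
  refine ⟨fun i => (key i).1, ?_⟩
  simp only [(key _).2]
  -- The functions `χ i` sum to `1` only on the frontier. The remainder `ψ` vanishes there, so it
  -- contributes no flux; hence the value does not depend on the atlas.
  set ψ : E p → ℝ := fun y => (1 - ∑ i, 𝒜.χ i y) * η y with hψ
  have hψs : ContDiff ℝ ∞ ψ := (contDiff_const.sub (ContDiff.sum fun i _ => 𝒜.smooth_χ i)).mul hη
  have hψz := hV.integral_gradDot_eq_zero hD hO hb hs hψs (hsub _) fun y hy => by
    simp [hψ, 𝒜.sum_χ y hy]
  have h1 : ∀ y, gradDot η V y = gradDot ψ V y + ∑ i, gradDot (fun y => 𝒜.χ i y * η y) V y := by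
    intro y
    rw [← gradDot_sum _ (fun i _ => (hsmi i).differentiable (by simp) y),
      ← gradDot_add (hψs.differentiable (by simp) y)
        ((ContDiff.sum fun i _ => hsmi i).differentiable (by simp) y)]
    congr 1
    funext z
    rw [← Finset.sum_mul, hψ]
    ring
  simp only [h1]
  rw [integral_add (hV.integrableOn_gradDot hO hb hψs (hsub _))
    (integrable_finsetSum _ fun i _ => hV.integrableOn_gradDot hO hb (hsmi i) (hsub _)),
    integral_finsetSum _ fun i _ => hV.integrableOn_gradDot hO hb (hsmi i) (hsub _), hψz, zero_add]

end AlgebraCauchy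

/-! ### Radial cutoffs and the value at the singularity -/

namespace AlgebraCauchy

open MeasureTheory Set Filter Topology

variable {p : ℕ}

/-- A cutoff function that is `0` near `x` and `1` away from `x`. -/
noncomputable def cutoff (x : E p) (r : ℝ) (y : E p) : ℝ :=
  Real.smoothTransition (‖y - x‖ ^ 2 / r ^ 2 - 1)

lemma contDiff_cutoff (x : E p) (r : ℝ) : ContDiff ℝ ∞ (cutoff x r) := by
  refine Real.smoothTransition.contDiff.comp ?_
  exact (((contDiff_id.sub contDiff_const).norm_sq ℝ).div_const _).sub contDiff_const

lemma hasDerivAt_smoothTransition (u : ℝ) :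
    HasDerivAt Real.smoothTransition (deriv Real.smoothTransition u) u :=
  ((Real.smoothTransition.contDiff (n := 1)).differentiable (by simp) u).hasDerivAt

lemma fderiv_cutoff (x : E p) (r : ℝ) (y v : E p) :
    fderiv ℝ (cutoff x r) y v =
      deriv Real.smoothTransition (‖y - x‖ ^ 2 / r ^ 2 - 1) * (2 / r ^ 2) * inner ℝ (y - x) v := by
  have h1 : HasFDerivAt (fun y : E p => ‖y - x‖ ^ 2 / r ^ 2 - 1) _ y :=
    ((((hasFDerivAt_id y).sub_const x).norm_sq).mul_const ((r ^ 2)⁻¹)).sub_const 1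
  have h2 := (hasDerivAt_smoothTransition (‖y - x‖ ^ 2 / r ^ 2 - 1)).comp_hasFDerivAt y h1
  have h3 : fderiv ℝ (cutoff x r) y = _ := h2.fderiv
  rw [h3]
  simp only [_root_.smul_apply, ContinuousLinearMap.comp_apply, ContinuousLinearMap.id_apply,
    innerSL_apply_apply, smul_eq_mul, nsmul_eq_mul, id]
  push_cast
  ring

lemma tsupport_cutoff_subset (x : E p) {r : ℝ} (hr : 0 < r) :
    tsupport (cutoff x r) ⊆ {x}ᶜ := by
  rintro y hy rfl
  refine (notMem_tsupport_iff_eventuallyEq.2 ?_) hy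
  filter_upwards [Metric.ball_mem_nhds y hr] with z hz
  rw [mem_ball_iff_norm] at hz
  refine Real.smoothTransition.zero_of_nonpos ?_
  rw [sub_nonpos, div_le_one (by positivity)]
  exact pow_le_pow_left₀ (norm_nonneg _) hz.le 2

lemma cutoff_eq_one {x y : E p} {r : ℝ} (hr : 0 < r) (h : 2 * r ≤ ‖y - x‖) :
    cutoff x r y = 1 := by
  refine Real.smoothTransition.one_of_one_le ?_
  have : 2 ≤ ‖y - x‖ ^ 2 / r ^ 2 := by
    rw [le_div_iff₀ (by positivity)]
    nlinarith [pow_le_pow_left₀ (by positivity) h 2]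
  linarith

/-- The radial profile of `∇(cutoff) · (y - x) ‖y - x‖^(-(p+1))`. -/
noncomputable def radialWeight (p : ℕ) (r ρ : ℝ) : ℝ :=
  deriv Real.smoothTransition (ρ ^ 2 / r ^ 2 - 1) * (2 / r ^ 2) * (ρ ^ 2 * (ρ ^ (p + 1))⁻¹)

lemma radialWeight_nonneg (p : ℕ) (r : ℝ) {ρ : ℝ} (hρ : 0 ≤ ρ) : 0 ≤ radialWeight p r ρ := by
  have := Real.smoothTransition.monotone.deriv_nonneg (x := ρ ^ 2 / r ^ 2 - 1)
  unfold radialWeight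
  positivity

lemma radialWeight_eq_zero (p : ℕ) {r ρ : ℝ} (hr : 0 < r) (h : 2 * r ≤ ρ) :
    radialWeight p r ρ = 0 := by
  have h2 : 2 ≤ ρ ^ 2 / r ^ 2 - 1 := by
    have : 4 ≤ ρ ^ 2 / r ^ 2 := by
      rw [le_div_iff₀ (by positivity)]
      nlinarith [pow_le_pow_left₀ (by positivity) h 2]
    linarith
  have h3 : deriv Real.smoothTransition (ρ ^ 2 / r ^ 2 - 1) = 0 := by
    have : Real.smoothTransition =ᶠ[𝓝 (ρ ^ 2 / r ^ 2 - 1)] fun _ => 1 := by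
      filter_upwards [Ioi_mem_nhds (show 1 < ρ ^ 2 / r ^ 2 - 1 by linarith)] with u hu
      exact Real.smoothTransition.one_of_one_le (le_of_lt hu)
    simp [this.deriv_eq]
  simp [radialWeight, h3]

/-- The factor `ρ^p` of polar coordinates turns the weight into the exact derivative of
`smoothTransition (ρ²/r² - 1)`. -/
lemma pow_mul_radialWeight (p : ℕ) (r : ℝ) {ρ : ℝ} (hρ : 0 < ρ) :
    ρ ^ p * radialWeight p r ρ =
      deriv Real.smoothTransition (ρ ^ 2 / r ^ 2 - 1) * (2 * ρ / r ^ 2) := by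
  unfold radialWeight
  field_simp
  ring

/-- In polar coordinates the integral is `n Vol` times the total increase of the transition function
from `0` to `1`, whatever `r` is. Integrability follows from the sign of the derivative and the
limit at infinity. -/
lemma integral_radialWeight (x : E p) {r : ℝ} (hr : 0 < r) :
    Integrable (fun y : E p => radialWeight p r ‖y - x‖) ∧
      ∫ y : E p, radialWeight p r ‖y - x‖ = (p + 1) * ballVolume p := by
  have hd : ∀ ρ ∈ Ici (0 : ℝ), HasDerivAt (fun ρ => Real.smoothTransition (ρ ^ 2 / r ^ 2 - 1))
      (deriv Real.smoothTransition (ρ ^ 2 / r ^ 2 - 1) * (2 * ρ / r ^ 2)) ρ := fun ρ _ => by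
    have h1 := ((hasDerivAt_pow 2 ρ).div_const (r ^ 2)).sub_const 1
    have h2 := (hasDerivAt_smoothTransition (ρ ^ 2 / r ^ 2 - 1)).comp ρ h1
    refine h2.congr_deriv ?_
    norm_num
  have hpos : ∀ ρ ∈ Ioi (0 : ℝ),
      0 ≤ deriv Real.smoothTransition (ρ ^ 2 / r ^ 2 - 1) * (2 * ρ / r ^ 2) := fun ρ hρ => by
    have := Real.smoothTransition.monotone.deriv_nonneg (x := ρ ^ 2 / r ^ 2 - 1)
    have h0 : 0 < ρ := hρ
    positivity
  have hlim : Tendsto (fun ρ : ℝ => Real.smoothTransition (ρ ^ 2 / r ^ 2 - 1)) atTop (𝓝 1) := by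
    refine tendsto_const_nhds.congr' ?_
    filter_upwards [eventually_ge_atTop (2 * r)] with ρ hρ
    refine (Real.smoothTransition.one_of_one_le ?_).symm
    have : 2 ≤ ρ ^ 2 / r ^ 2 := by
      rw [le_div_iff₀ (by positivity)]
      nlinarith [pow_le_pow_left₀ (by positivity) hρ 2]
    linarith
  have hdim : Module.finrank ℝ (E p) = p + 1 := by simp
  have hcongr : ∀ ρ ∈ Ioi (0 : ℝ), deriv Real.smoothTransition (ρ ^ 2 / r ^ 2 - 1) * (2 * ρ / r ^ 2)
      = ρ ^ (Module.finrank ℝ (E p) - 1) • radialWeight p r ρ := fun ρ hρ => by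
    rw [hdim, Nat.add_sub_cancel, smul_eq_mul, pow_mul_radialWeight p r hρ]
  have hi : Integrable (fun y : E p => radialWeight p r ‖y‖) := by
    rw [integrable_fun_norm_addHaar]
    exact (integrableOn_Ioi_deriv_of_nonneg' hd hpos hlim).congr_fun hcongr measurableSet_Ioi
  refine ⟨hi.comp_sub_right x, ?_⟩
  rw [integral_sub_right_eq_self (fun y : E p => radialWeight p r ‖y‖) x,
    integral_fun_norm_addHaar volume (radialWeight p r),
    ← setIntegral_congr_fun measurableSet_Ioi hcongr,
    integral_Ioi_of_hasDerivAt_of_nonneg' hd hpos hlim, hdim]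
  have : Real.smoothTransition (0 ^ 2 / r ^ 2 - 1) = 0 :=
    Real.smoothTransition.zero_of_nonpos (by norm_num)
  rw [this]
  simp [ballVolume, Measure.real]

lemma ballVolume_pos (p : ℕ) : 0 < ballVolume p :=
  ENNReal.toReal_pos (Metric.measure_ball_pos volume _ one_pos).ne' measure_ball_lt_top.ne

variable {W : Type*} [NormedAddCommGroup W] [NormedSpace ℝ W]

/-- The flux of a solenoidal field with a singularity of the type of `(y - x) ‖y - x‖^(-(p+1)) f`
at `x` is the value of `f` at `x`. -/
theorem IsSolenoidal.flux_eq_value [CompleteSpace W] {D : Set (E p)} {x : E p}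
    {V : Fin (p + 1) → E p → W}
    (hV : IsSolenoidal V D {x}ᶜ) (hD : IsOpen D) (hb : Bornology.IsBounded D)
    (hs : HasSmoothBoundary D) (hx : x ∈ D) {f : E p → W} (hf : ContinuousAt f x)
    (hVf : ∀ y, ∑ k, (y k - x k) • V k y = (1 / ((p + 1 : ℝ) * ballVolume p) *
      (‖y - x‖ ^ 2 * (‖y - x‖ ^ (p + 1))⁻¹)) • f y) (𝒜 : BoundaryAtlas D) :
    (∀ i, Integrable fun t => ∑ k, (𝒜.chart i).outwardNormal t k •
      𝒜.χ i ((𝒜.chart i).param t) • V k ((𝒜.chart i).param t)) ∧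
    ∑ i, ∫ t, ∑ k, (𝒜.chart i).outwardNormal t k •
      𝒜.χ i ((𝒜.chart i).param t) • V k ((𝒜.chart i).param t) = f x := by
  set c : ℝ := 1 / ((p + 1 : ℝ) * ballVolume p) with hc
  have hv := ballVolume_pos p
  have hc0 : 0 ≤ c := by positivity
  have key : ∀ r : ℝ, 0 < r → (∀ y ∈ frontier D, 2 * r ≤ ‖y - x‖) →
      (∀ i, Integrable fun t => ∑ k, (𝒜.chart i).outwardNormal t k •
        𝒜.χ i ((𝒜.chart i).param t) • V k ((𝒜.chart i).param t)) ∧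
      ∑ i, ∫ t, ∑ k, (𝒜.chart i).outwardNormal t k •
        𝒜.χ i ((𝒜.chart i).param t) • V k ((𝒜.chart i).param t) =
          ∫ y in D, gradDot (cutoff x r) V y := fun r hr hrD =>
    hV.flux_eq hD isOpen_compl_singleton hb hs (contDiff_cutoff x r) (tsupport_cutoff_subset x hr)
      (fun y hy => cutoff_eq_one hr (hrD y hy)) 𝒜
  -- The gradient of a radial cutoff is parallel to `y - x`, so only the radial component of `V`
  -- enters.
  have hgrad : ∀ r y, gradDot (cutoff x r) V y = (c * radialWeight p r ‖y - x‖) • f y := by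
    intro r y
    have h1 : ∀ k, inner ℝ (y - x) (EuclideanSpace.single k 1) = y k - x k := by
      simp [EuclideanSpace.inner_single_right]
    simp only [gradDot, fderiv_cutoff, h1]
    simp only [mul_smul _ (y _ - x _)]
    rw [← Finset.smul_sum, hVf, smul_smul]
    congr 1
    unfold radialWeight
    ring
  obtain ⟨δ₀, hδ₀, hball⟩ := Metric.isOpen_iff.1 hD x hx
  have hfr : ∀ δ ≤ δ₀, ∀ y ∈ frontier D, 2 * (δ / 2) ≤ ‖y - x‖ := fun δ hδ y hy => by
    rw [hD.frontier_eq] at hy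
    by_contra hlt
    refine hy.2 (hball ?_)
    rw [mem_ball_iff_norm]
    linarith
  refine ⟨(key (δ₀ / 2) (by positivity) (hfr δ₀ le_rfl)).1, ?_⟩
  -- The flux does not depend on `r`, so `r` may be chosen after `ε`: with `r = δ/2` the weight
  -- lives in the ball of radius `δ`, where `f` is within `ε` of `f x`.
  refine eq_of_forall_dist_le fun ε hε => ?_
  obtain ⟨δ₁, hδ₁, hfδ⟩ := Metric.continuousAt_iff.1 hf ε hε
  set δ := min δ₀ δ₁ with hδ
  have hδ0 : 0 < δ := lt_min hδ₀ hδ₁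
  set r := δ / 2 with hr
  have hr0 : 0 < r := by positivity
  rw [(key r hr0 (hfr δ (min_le_left _ _))).2, dist_eq_norm]
  obtain ⟨hwi, hwI⟩ := integral_radialWeight x hr0
  have hw0 : ∀ y : E p, δ ≤ ‖y - x‖ → radialWeight p r ‖y - x‖ = 0 := fun y hy =>
    radialWeight_eq_zero p hr0 (by rw [hr]; linarith)
  have hwD : ∫ y in D, c * radialWeight p r ‖y - x‖ = 1 := by
    rw [setIntegral_eq_integral_of_forall_compl_eq_zero, integral_const_mul, hwI, hc]
    · field_simp
    · intro y hy
      rw [hw0, mul_zero]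
      by_contra hlt
      refine hy (hball ?_)
      rw [mem_ball_iff_norm]
      exact (not_le.1 hlt).trans_le (min_le_left _ _)
  have hwc : IntegrableOn (fun y => c * radialWeight p r ‖y - x‖) D := (hwi.const_mul c).integrableOn
  have hgi := hV.integrableOn_gradDot isOpen_compl_singleton hb (contDiff_cutoff x r)
    (tsupport_cutoff_subset x hr0)
  have h1 : ∫ y in D, (c * radialWeight p r ‖y - x‖) • f x = f x := by
    rw [integral_smul_const, hwD, one_smul]
  rw [← h1, ← integral_sub hgi (hwc.smul_const _)]
  have h2 : ∫ y in D, c * radialWeight p r ‖y - x‖ * ε = ε := by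
    rw [integral_mul_const, hwD, one_mul]
  rw [← h2]
  refine norm_integral_le_of_norm_le (hwc.mul_const ε) (ae_of_all _ fun y => ?_)
  have hwn := radialWeight_nonneg p r (norm_nonneg (y - x))
  rw [hgrad, ← smul_sub, norm_smul, Real.norm_of_nonneg (by positivity)]
  by_cases hy : δ ≤ ‖y - x‖
  · simp [hw0 y hy]
  · refine mul_le_mul_of_nonneg_left ?_ (by positivity)
    rw [← dist_eq_norm]
    refine (hfδ ?_).le
    rw [dist_eq_norm]
    exact (not_le.1 hy).trans_le (min_le_right _ _)

end AlgebraCauchy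

/-! ### Algebra of the Cauchy kernel and the Cauchy formula -/

namespace AlgebraCauchy

open MeasureTheory Set Filter Topology

section Fundamental

variable {p : ℕ} {A : Type*} [CommRing A] [Algebra ℝ A]

/-- The coefficients `b` of the Cauchy kernel. -/
noncomputable def cauchyCoeff (e : Module.Basis (Fin (p + 1)) ℝ A) (m : Fin p) (i : Fin (p + 1)) :
    A :=
  (1 / ((p + 1 : ℝ) * ballVolume p)) • if i = 0 then e m.succ else if i = m.succ then 1 else 0

/-- The entry `j = 0` is the hypothesis, rewritten as `-∑_{m ≥ 1} e_m² = 1`. For the pair `0, j` the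
terms `-e_j` and `e_j` cancel, and for two distinct positive indices no `m` meets both. -/
theorem isFundamental_cauchyCoeff (e : Module.Basis (Fin (p + 1)) ℝ A) (he : e 0 = 1)
    (hsum : ∑ m, e m ^ 2 = 0) : IsFundamental (crCoeff e) (cauchyCoeff e) := by
  rw [Fin.sum_univ_succ, he, one_pow] at hsum
  have h1 : ∑ m : Fin p, -(e m.succ * e m.succ) = 1 := by
    rw [Finset.sum_neg_distrib, neg_eq_iff_add_eq_zero, add_comm]
    simpa only [sq] using hsum
  refine ⟨fun j => ?_, ?_⟩
  · cases j using Fin.cases with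
    | zero => simp [crCoeff, cauchyCoeff, ← Finset.smul_sum, ← h1]
    | succ j => simp [crCoeff, cauchyCoeff, Fin.succ_ne_zero]
  · have key : ∀ j i : Fin p, j ≠ i → ∀ m : Fin p,
        (if j = m then (1 : A) else 0) * (if i = m then 1 else 0) = 0 := by
      intro j i hji m
      by_cases h : j = m
      · subst h; simp [Ne.symm hji]
      · simp [h]
    have h0 : ∀ j : Fin p, ∑ m, (crCoeff e m 0 * cauchyCoeff e m j.succ +
        crCoeff e m j.succ * cauchyCoeff e m 0) = 0 := by
      intro j
      simp [crCoeff, cauchyCoeff, Fin.succ_ne_zero, Finset.sum_add_distrib]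
    intro i j hij
    cases i using Fin.cases with
    | zero =>
      cases j using Fin.cases with
      | zero => exact absurd rfl hij
      | succ j =>
        rw [← h0 j]
        exact Finset.sum_congr rfl fun m _ => add_comm _ _
    | succ i =>
      cases j using Fin.cases with
      | zero => exact h0 i
      | succ j =>
        have hij' : i ≠ j := fun h => hij (h ▸ rfl)
        refine Finset.sum_eq_zero fun m _ => ?_
        simp only [crCoeff, cauchyCoeff, Fin.succ_ne_zero, if_false, Fin.succ_inj,
          mul_smul_comm, key _ _ hij', key _ _ hij'.symm, smul_zero, add_zero]

/-- The coefficients of the matrix product `aᵀ b`. -/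
noncomputable def kernelCoeff (a b : Fin p → Fin (p + 1) → A) (k i : Fin (p + 1)) : A :=
  ∑ m, a m k * b m i

/-- Symmetrizing the double sum replaces `kernelCoeff` by its symmetric part, a multiple of the
identity; only the trace of `s` is left. -/
lemma IsFundamental.sum_smul_kernelCoeff {a b : Fin p → Fin (p + 1) → A} (h : IsFundamental a b)
    {s : Fin (p + 1) → Fin (p + 1) → ℝ} (hs : ∀ k i, s k i = s i k) :
    ∑ k, ∑ i, s k i • kernelCoeff a b k i =
      (1 / ((p + 1 : ℝ) * ballVolume p) * ∑ k, s k k) • (1 : A) := by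
  set c := 1 / ((p + 1 : ℝ) * ballVolume p) with hc
  have h1 : ∀ k i, kernelCoeff a b k i + kernelCoeff a b i k =
      if k = i then (2 * c) • (1 : A) else 0 := by
    intro k i
    split_ifs with hki
    · subst hki
      rw [kernelCoeff, h.1 k, mul_smul, two_smul]
    · rw [kernelCoeff, kernelCoeff, ← Finset.sum_add_distrib]
      rw [← h.2 i k (Ne.symm hki)]
  have h2 : (2 : ℝ) • ∑ k, ∑ i, s k i • kernelCoeff a b k i =
      ∑ k, ∑ i, s k i • (kernelCoeff a b k i + kernelCoeff a b i k) := by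
    rw [two_smul]
    nth_rw 2 [Finset.sum_comm]
    simp only [← Finset.sum_add_distrib, smul_add]
    simp only [hs]
  have h3 : (2 : ℝ) • ∑ k, ∑ i, s k i • kernelCoeff a b k i =
      (2 : ℝ) • (c * ∑ k, s k k) • (1 : A) := by
    rw [h2]
    simp only [h1, smul_ite, smul_zero, Finset.sum_ite_eq, Finset.mem_univ, if_true, smul_smul]
    rw [← Finset.sum_smul, Finset.mul_sum, Finset.mul_sum]
    congr 1
    exact Finset.sum_congr rfl fun k _ => by ring
  have h4 := congrArg (fun z => (2⁻¹ : ℝ) • z) h3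
  simpa [smul_smul] using h4

/-- The scalar factors `(y_i - x_i) ‖y - x‖^(-(p+1))` of the Cauchy kernel. -/
noncomputable def newton (x : E p) (i : Fin (p + 1)) (y : E p) : ℝ :=
  (‖y - x‖ ^ (p + 1))⁻¹ * (y i - x i)

lemma cauchyField_eq (a b : Fin p → Fin (p + 1) → A) (f : E p → A) (x : E p)
    (k : Fin (p + 1)) (y : E p) :
    cauchyField a b f x k y = ∑ i, newton x i y • (f y * kernelCoeff a b k i) := by
  simp only [cauchyField, phi, kernelCoeff, newton, Finset.smul_sum, Finset.mul_sum, smul_smul,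
    mul_smul_comm]
  exact Finset.sum_comm

lemma hasFDerivAt_newton {x y : E p} (hy : y ≠ x) (i : Fin (p + 1)) :
    HasFDerivAt (newton x i) (((‖y - x‖ ^ (p + 1))⁻¹ • EuclideanSpace.proj (𝕜 := ℝ) i) +
      (y i - x i) • ((-(p + 1 : ℝ) * (‖y - x‖ ^ (p + 3))⁻¹) • innerSL ℝ (y - x))) y := by
  have hn : 0 < ‖y - x‖ := norm_pos_iff.2 (sub_ne_zero.2 hy)
  have h1 : HasFDerivAt (fun y : E p => ‖y - x‖) ((‖y - x‖)⁻¹ • innerSL ℝ (y - x)) y := by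
    have h2 := (((hasFDerivAt_id y).sub_const x).norm_sq).sqrt (by simpa using hn.ne')
    simp only [id, Real.sqrt_sq (norm_nonneg _)] at h2
    refine h2.congr_fderiv ?_
    ext v
    simp
    field_simp
  have h3 : HasFDerivAt (fun y : E p => (‖y - x‖ ^ (p + 1))⁻¹)
      ((-(p + 1 : ℝ) * (‖y - x‖ ^ (p + 3))⁻¹) • innerSL ℝ (y - x)) y := by
    have h4 := ((hasDerivAt_pow (p + 1) ‖y - x‖).fun_inv (by positivity)).comp_hasFDerivAt y h1
    refine h4.congr_fderiv ?_
    ext v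
    simp only [_root_.smul_apply, smul_eq_mul]
    push_cast
    field_simp
    ring
  have h5 : HasFDerivAt (fun y : E p => y i - x i) (EuclideanSpace.proj (𝕜 := ℝ) i) y :=
    (EuclideanSpace.proj (𝕜 := ℝ) i).hasFDerivAt.sub_const (x i)
  exact h3.mul h5

/-- The trace-free symmetric matrix of the derivatives of `newton`. -/
lemma fderiv_newton_single {x y : E p} (hy : y ≠ x) (i k : Fin (p + 1)) :
    fderiv ℝ (newton x i) y (EuclideanSpace.single k 1) =
      (‖y - x‖ ^ (p + 1))⁻¹ * (if k = i then 1 else 0) -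
        (p + 1) * (‖y - x‖ ^ (p + 3))⁻¹ * ((y k - x k) * (y i - x i)) := by
  rw [(hasFDerivAt_newton hy i).fderiv]
  simp only [_root_.add_apply, _root_.smul_apply, smul_eq_mul, innerSL_apply_apply,
    EuclideanSpace.inner_single_right]
  simp only [PiLp.proj_apply, PiLp.single_apply, eq_comm (a := i), PiLp.sub_apply, conj_trivial]
  ring

lemma sum_fderiv_newton {x y : E p} (hy : y ≠ x) :
    ∑ k, fderiv ℝ (newton x k) y (EuclideanSpace.single k 1) = 0 := by
  have hn : 0 < ‖y - x‖ := norm_pos_iff.2 (sub_ne_zero.2 hy)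
  have h1 : ∑ k, (y k - x k) * (y k - x k) = ‖y - x‖ ^ 2 := by
    rw [EuclideanSpace.norm_sq_eq]
    simp [← sq]
  simp only [fderiv_newton_single hy, Finset.sum_sub_distrib, ← Finset.mul_sum, h1]
  simp
  field_simp
  ring

variable (e : Module.Basis (Fin (p + 1)) ℝ A)

/-- Multiplication by `a`, in components. -/
noncomputable def mulComponents (a : A) : (Fin (p + 1) → ℝ) →L[ℝ] (Fin (p + 1) → ℝ) :=
  LinearMap.toContinuousLinearMap
    (e.equivFun.toLinearMap ∘ₗ LinearMap.mulRight ℝ a ∘ₗ e.equivFun.symm.toLinearMap)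

lemma mulComponents_apply (a : A) (v : Fin (p + 1) → ℝ) :
    mulComponents e a v = e.equivFun (e.equivFun.symm v * a) := rfl

lemma components_cauchyField (a b : Fin p → Fin (p + 1) → A) (f : E p → A) (x : E p)
    (k : Fin (p + 1)) : components e (cauchyField a b f x k) =
      fun y => ∑ i, newton x i y • mulComponents e (kernelCoeff a b k i) (components e f y) := by
  funext y
  simp only [components, cauchyField_eq, mulComponents_apply, map_sum, map_smul,
    LinearEquiv.symm_apply_apply]

lemma IsADifferentiableOn.sum_partialDeriv_mul {e} {f : E p → A} {D : Set (E p)}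
    (hf : IsADifferentiableOn e f D) {x : E p} (hx : x ∈ D) (m : Fin p) :
    ∑ k, partialDeriv e f k x * crCoeff e m k = 0 := by
  rw [Fin.sum_univ_succ]
  simp [crCoeff, Fin.succ_ne_zero, (hf x hx).2 m.succ, mul_comm]

/-- By the product rule the divergence splits in two: derivatives of `f` (`h3`) cancel by the
Cauchy–Riemann equations, and derivatives of the Newton field (`h4`) because their matrix is
symmetric and trace-free. -/
theorem isSolenoidal_cauchyField {b : Fin p → Fin (p + 1) → A}
    (hb : IsFundamental (crCoeff e) b) {D : Set (E p)} {f : E p → A}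
    (hfc : ContinuousOn (components e f) (closure D)) (hf : IsADifferentiableOn e f D) (x : E p) :
    IsSolenoidal (fun k => components e (cauchyField (crCoeff e) b f x k)) D {x}ᶜ := by
  have hder : ∀ y ∈ D ∩ {x}ᶜ, ∀ k, HasFDerivAt (components e (cauchyField (crCoeff e) b f x k))
      (∑ i, (newton x i y • (mulComponents e (kernelCoeff (crCoeff e) b k i)).comp
        (fderiv ℝ (components e f) y) + (fderiv ℝ (newton x i) y).smulRight
          (mulComponents e (kernelCoeff (crCoeff e) b k i) (components e f y)))) y := by
    intro y hy k
    rw [components_cauchyField]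
    refine HasFDerivAt.fun_sum fun i _ => ?_
    exact (hasFDerivAt_newton hy.2 i).differentiableAt.hasFDerivAt.fun_smul
      ((mulComponents e _).hasFDerivAt.comp y (hf y hy.1).1.hasFDerivAt)
  refine ⟨fun k => ?_, fun y hy k => (hder y hy k).differentiableAt, fun y hy => ?_⟩
  · rw [components_cauchyField]
    refine continuousOn_finsetSum _ fun i _ => ContinuousOn.fun_smul (fun y hy => ?_) ?_
    · exact (hasFDerivAt_newton hy.2 i).continuousAt.continuousWithinAt
    · exact (mulComponents e _).continuous.comp_continuousOn (hfc.mono inter_subset_left)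
  · simp only [(hder y hy _).fderiv, _root_.sum_apply, _root_.add_apply, _root_.smul_apply,
      ContinuousLinearMap.smulRight_apply, ContinuousLinearMap.comp_apply, Finset.sum_add_distrib,
      mulComponents_apply]
    have h1 : ∀ k, e.equivFun.symm (fderiv ℝ (components e f) y (EuclideanSpace.single k 1)) =
      partialDeriv e f k y := fun k => rfl
    have h2 : ∀ i, ∑ k, partialDeriv e f k y * kernelCoeff (crCoeff e) b k i = 0 := by
      intro i
      simp only [kernelCoeff, Finset.mul_sum]
      rw [Finset.sum_comm]
      refine Finset.sum_eq_zero fun m _ => ?_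
      simp only [← mul_assoc]
      rw [← Finset.sum_mul, hf.sum_partialDeriv_mul hy.1, zero_mul]
    have h3 : ∑ k, ∑ i, newton x i y •
        e.equivFun (partialDeriv e f k y * kernelCoeff (crCoeff e) b k i) = 0 := by
      rw [Finset.sum_comm]
      refine Finset.sum_eq_zero fun i _ => ?_
      rw [← Finset.smul_sum, ← map_sum, h2, map_zero, smul_zero]
    have h4 : ∑ k, ∑ i, fderiv ℝ (newton x i) y (EuclideanSpace.single k 1) •
        kernelCoeff (crCoeff e) b k i = 0 := by
      rw [hb.sum_smul_kernelCoeff (s := fun k i => fderiv ℝ (newton x i) y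
        (EuclideanSpace.single k 1)), sum_fderiv_newton hy.2, mul_zero, zero_smul]
      intro k i
      simp only [fderiv_newton_single hy.2, eq_comm (a := i), mul_comm (y i - x i)]
    simp only [h1]
    rw [h3, zero_add]
    simp only [components, LinearEquiv.symm_apply_apply, ← map_smul, ← map_sum,
      ← mul_smul_comm, ← Finset.mul_sum, h4, mul_zero, map_zero]

lemma sum_smul_components_cauchyField {a b : Fin p → Fin (p + 1) → A}
    (hb : IsFundamental a b) (f : E p → A) (x y : E p) :
    ∑ k, (y k - x k) • components e (cauchyField a b f x k) y =
      (1 / ((p + 1 : ℝ) * ballVolume p) * (‖y - x‖ ^ 2 * (‖y - x‖ ^ (p + 1))⁻¹)) •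
        components e f y := by
  -- The symmetric matrix is `(y_k - x_k)(y_i - x_i)` times a scalar. At `y = x` both sides vanish,
  -- so that point needs no exclusion.
  have h1 : ∑ k, ∑ i, ((y k - x k) * newton x i y) • kernelCoeff a b k i = _ :=
    hb.sum_smul_kernelCoeff fun k i => by simp only [newton]; ring
  have h2 : ∑ k, (y k - x k) * newton x k y = ‖y - x‖ ^ 2 * (‖y - x‖ ^ (p + 1))⁻¹ := by
    rw [EuclideanSpace.norm_sq_eq, Finset.sum_mul]
    refine Finset.sum_congr rfl fun k _ => ?_
    simp [newton]
    ring
  rw [h2] at h1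
  simp only [components, ← map_smul, ← map_sum, cauchyField_eq, Finset.smul_sum, smul_smul,
    ← mul_smul_comm, ← Finset.mul_sum, h1]
  rw [mul_smul_comm, mul_one]

theorem satisfyCauchyFormula (he : e 0 = 1) (hsum : ∑ m, e m ^ 2 = 0) :
    SatisfyCauchyFormula e := by
  have hb := isFundamental_cauchyCoeff e he hsum
  refine ⟨cauchyCoeff e, hb, fun D hD hbd hs f hfc hf x hx => ?_⟩
  obtain ⟨𝒜, -⟩ := exists_partition hD hbd hs
  refine ⟨⟨𝒜⟩, fun 𝒜 => ?_⟩
  have hV := isSolenoidal_cauchyField e hb hfc hf x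
  have hcomp : ∀ i, components e (𝒜.integrand (cauchyField (crCoeff e) (cauchyCoeff e) f x) i) =
      fun t => ∑ k, (𝒜.chart i).outwardNormal t k • 𝒜.χ i ((𝒜.chart i).param t) •
        components e (cauchyField (crCoeff e) (cauchyCoeff e) f x k) ((𝒜.chart i).param t) := by
    intro i
    funext t
    simp [components, BoundaryAtlas.integrand, GraphChart.pullback]
  obtain ⟨h1, h2⟩ := hV.flux_eq_value hD hbd hs hx (f := components e f)
    (hf x hx).1.continuousAt (sum_smul_components_cauchyField e hb f x) 𝒜
  simp only [hcomp]
  refine ⟨h1, ?_⟩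
  rw [← map_sum, h2, components, LinearEquiv.symm_apply_apply]

end Fundamental

end AlgebraCauchy

theorem mainTheorem4 :
    (∀ (p : ℕ) (A : Type*) [CommRing A] [Algebra ℝ A] (e : Module.Basis (Fin (p + 1)) ℝ A),
      e 0 = 1 → ∑ m, e m ^ 2 = 0 → AlgebraCauchy.SatisfyCauchyFormula e) ∧
    (Complex.basisOneI 0 = 1 ∧ ∑ m, Complex.basisOneI m ^ 2 = 1 + Complex.I ^ 2 ∧
      (1 : ℂ) + Complex.I ^ 2 = 0) := by
  refine ⟨fun p A _ _ e he hsum => AlgebraCauchy.satisfyCauchyFormula e he hsum, ?_, ?_, ?_⟩ <;>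
    simp [Complex.coe_basisOneI, Fin.sum_univ_two]
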